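/- Let $\alpha\in(0,1)$. For a positive integer $n$ and a real number $\theta>0$, let $K=K_{n,\theta,\alpha}$ be the number of parts of a Pitman random partition of $n$, that is, the random partition of $n$ whose component counts $(C_1,\dots,C_n)$ ($C_i$ being the number of parts of size $i$) follow the Pitman sampling formula $$\mathsf P\bigl((C_1,\dots,C_n)=(c_1,\dots,c_n)\bigr)=n!\,\frac{(\theta)_{k;\alpha}}{(\theta)_n}\prod_{i=1}^n\left(\frac{(1-\alpha)_{i-1}}{i!}\right)^{c_i}\frac1{c_i!},\qquad k=\sum_{i=1}^n c_i,$$ for all nonnegative integers $c_1,\dots,c_n$ with $\sum_{i=1}^n i c_i=n$, where $(x)_{0;y}=1$, $(x)_{i;y}=x(x+y)\cdots(x+(i-1)y)$ for $i\ge 1$, and $(x)_i=(x)_{i;1}$; thus $K=\sum_{i=1}^n C_i$. Consider the asymptotic regime in which $n\to\infty$ and $\theta\to\infty$ with $\theta/n\to0$, while $\alpha$ is fixed. Then for every fixed integer $r\ge 1$, $$\mathsf E\left[\left(\frac{\alpha K}{\theta\left\{\left(\frac{n+\theta}{\theta}\right)^\alpha-1\right\}}\right)^r\right]=1+O\left(\frac{\theta^{2\alpha}}{n^{2\alpha}}+\frac{\theta}{n}+\frac1\theta\right).$$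 If in addition $\theta^{2\alpha+1}/n^{2\alpha}\to0$ and $\theta^2/n\to0$, then for every fixed integer $r\ge 1$, $$\mathsf E\left[\left(\frac{\alpha K}{\theta\left\{\left(\frac{n+\theta}{\theta}\right)^\alpha-1\right\}}\right)^r\right]=1+r^2\,\frac{\alpha(1-\alpha)}{2\theta}+O\left(\frac{\theta^{2\alpha}}{n^{2\alpha}}+\frac{\theta}{n}+\frac1\theta\left(\frac{\theta^\alpha}{n^\alpha}+\frac1\theta\right)\right).$$ -/

import Mathlib

open scoped Topology Asymptotics

noncomputable section

namespace PitmanPartition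

/-- The generalized rising factorial `(x)_{i;y} = x (x + y) (x + 2 y) ⋯ (x + (i - 1) y)`,
with `(x)_{0;y} = 1`. The ordinary rising factorial is `(x)_i = (x)_{i;1}`. -/
def risingFactorial (x y : ℝ) (i : ℕ) : ℝ := ∏ j ∈ Finset.range i, (x + j * y)

/-- The component count `c_i`: the number of parts of size `i` of a partition of `n`. -/
def componentCount {n : ℕ} (p : n.Partition) (i : ℕ) : ℕ := p.parts.count i

/-- The length `k = c_1 + ⋯ + c_n` of a partition of `n`. -/
def length {n : ℕ} (p : n.Partition) : ℕ := ∑ i ∈ Finset.Icc 1 n, componentCount p i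

/-- The Pitman sampling formula: the probability
`n! (θ)_{k;α} / (θ)_n ∏_{i=1}^n ((1 - α)_{i-1} / i!)^{c_i} / c_i!`
of the partition with component counts `c_1, …, c_n`, where `k` is its length. -/
def pitmanWeight (n : ℕ) (α θ : ℝ) (p : n.Partition) : ℝ :=
  (n.factorial : ℝ) * (risingFactorial θ α (length p) / risingFactorial θ 1 n) *
    ∏ i ∈ Finset.Icc 1 n,
      ((risingFactorial (1 - α) 1 (i - 1) / (i.factorial : ℝ)) ^ componentCount p i *
        (1 / ((componentCount p i).factorial : ℝ)))

theorem risingFactorial_nonneg {x y : ℝ} (hx : 0 ≤ x) (hy : 0 ≤ y) (i : ℕ) :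
    0 ≤ risingFactorial x y i :=
  Finset.prod_nonneg fun j _ => by positivity

theorem risingFactorial_pos {x y : ℝ} (hx : 0 < x) (hy : 0 ≤ y) (i : ℕ) :
    0 < risingFactorial x y i :=
  Finset.prod_pos fun j _ => by positivity

theorem pitmanWeight_nonneg (n : ℕ) {α θ : ℝ} (hα0 : 0 ≤ α) (hα1 : α < 1) (hθ : 0 < θ)
    (p : n.Partition) : 0 ≤ pitmanWeight n α θ p := by
  have h1 := risingFactorial_nonneg hθ.le hα0 (length p)
  have h2 := risingFactorial_nonneg hθ.le zero_le_one n
  refine mul_nonneg (by positivity) (Finset.prod_nonneg fun i _ => ?_)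
  have h3 := risingFactorial_nonneg (sub_nonneg.2 hα1.le) zero_le_one (i - 1)
  positivity

theorem risingFactorial_succ (x y : ℝ) (i : ℕ) :
    risingFactorial x y (i + 1) = risingFactorial x y i * (x + i * y) :=
  Finset.prod_range_succ _ _

theorem risingFactorial_succ' (x y : ℝ) (i : ℕ) :
    risingFactorial x y (i + 1) = x * risingFactorial (x + y) y i := by
  unfold risingFactorial
  rw [Finset.prod_range_succ', mul_comm]
  congr 1
  · simp
  · refine Finset.prod_congr rfl fun j _ => ?_
    push_cast
    ring

/-- Vandermonde's identity for rising factorials. -/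
theorem vandermonde (x y : ℝ) (m : ℕ) :
    ∑ ab ∈ Finset.HasAntidiagonal.antidiagonal m, risingFactorial x 1 ab.1 / (ab.1.factorial : ℝ) *
      (risingFactorial y 1 ab.2 / (ab.2.factorial : ℝ)) =
    risingFactorial (x + y) 1 m / (m.factorial : ℝ) := by
  induction m with
  | zero => simp [risingFactorial]
  | succ m ih =>
    set u : ℕ → ℝ := fun a => risingFactorial x 1 a / (a.factorial : ℝ) with hu
    set v : ℕ → ℝ := fun a => risingFactorial y 1 a / (a.factorial : ℝ) with hv
    have hs : ∀ (z : ℝ) (a : ℕ), ((a + 1 : ℕ) : ℝ) *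
        (risingFactorial z 1 (a + 1) / ((a + 1).factorial : ℝ)) =
        risingFactorial z 1 a / (a.factorial : ℝ) * (z + a) := by
      intro z a
      rw [risingFactorial_succ, Nat.factorial_succ]
      have : (a.factorial : ℝ) ≠ 0 := by positivity
      push_cast
      field_simp
    have h1 : ∑ ab ∈ Finset.HasAntidiagonal.antidiagonal (m + 1), (ab.1 : ℝ) * (u ab.1 * v ab.2) =
        ∑ ab ∈ Finset.HasAntidiagonal.antidiagonal m, (x + ab.1) * (u ab.1 * v ab.2) := by
      rw [Finset.Nat.antidiagonal_succ, Finset.sum_cons, Finset.sum_map]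
      simp only [Nat.cast_zero, zero_mul, zero_add]
      refine Finset.sum_congr rfl fun ab _ => ?_
      have := hs x ab.1
      simp only [hu, Function.Embedding.prodMap, Function.Embedding.coeFn_mk, Prod.map,
        Function.Embedding.refl_apply, Nat.succ_eq_add_one]
      rw [← mul_assoc, this]
      ring
    have h2 : ∑ ab ∈ Finset.HasAntidiagonal.antidiagonal (m + 1), (ab.2 : ℝ) * (u ab.1 * v ab.2) =
        ∑ ab ∈ Finset.HasAntidiagonal.antidiagonal m, (y + ab.2) * (u ab.1 * v ab.2) := by
      rw [Finset.Nat.antidiagonal_succ', Finset.sum_cons, Finset.sum_map]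
      simp only [Nat.cast_zero, zero_mul, zero_add]
      refine Finset.sum_congr rfl fun ab _ => ?_
      have := hs y ab.2
      simp only [hv, Function.Embedding.prodMap, Function.Embedding.coeFn_mk, Prod.map,
        Function.Embedding.refl_apply, Nat.succ_eq_add_one]
      rw [mul_left_comm, this]
      ring
    have h3 : ((m + 1 : ℕ) : ℝ) * ∑ ab ∈ Finset.HasAntidiagonal.antidiagonal (m + 1), u ab.1 * v ab.2 =
        (x + y + m) * ∑ ab ∈ Finset.HasAntidiagonal.antidiagonal m, u ab.1 * v ab.2 := by
      have e1 : ((m + 1 : ℕ) : ℝ) * ∑ ab ∈ Finset.HasAntidiagonal.antidiagonal (m + 1), u ab.1 * v ab.2 =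
          ∑ ab ∈ Finset.HasAntidiagonal.antidiagonal (m + 1), (ab.1 : ℝ) * (u ab.1 * v ab.2) +
          ∑ ab ∈ Finset.HasAntidiagonal.antidiagonal (m + 1), (ab.2 : ℝ) * (u ab.1 * v ab.2) := by
        rw [Finset.mul_sum, ← Finset.sum_add_distrib]
        refine Finset.sum_congr rfl fun ab hab => ?_
        rw [← Finset.HasAntidiagonal.mem_antidiagonal.1 hab]
        push_cast
        ring
      rw [e1, h1, h2, Finset.mul_sum, ← Finset.sum_add_distrib]
      refine Finset.sum_congr rfl fun ab hab => ?_
      rw [← Finset.HasAntidiagonal.mem_antidiagonal.1 hab]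
      push_cast
      ring
    have h4 := hs (x + y) m
    have hm : ((m + 1 : ℕ) : ℝ) ≠ 0 := by positivity
    apply mul_left_cancel₀ hm
    rw [h4, h3, ih]
    ring

/-- The product over block sizes in the sampling formula, for a multiset of block sizes. -/
def blockWeight (a : ℕ → ℝ) (N : ℕ) (s : Multiset ℕ) : ℝ :=
  ∏ i ∈ Finset.Icc 1 N, (a i ^ s.count i * (1 / ((s.count i).factorial : ℝ)))

theorem blockWeight_cons (a : ℕ → ℝ) (N : ℕ) (s : Multiset ℕ) {j : ℕ}
    (hj : j ∈ Finset.Icc 1 N) :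
    ((s.count j + 1 : ℕ) : ℝ) * blockWeight a N (j ::ₘ s) = a j * blockWeight a N s := by
  unfold blockWeight
  rw [← Finset.mul_prod_erase _ _ hj, ← Finset.mul_prod_erase _ _ hj]
  have h : ∏ i ∈ (Finset.Icc 1 N).erase j, (a i ^ (j ::ₘ s).count i *
      (1 / (((j ::ₘ s).count i).factorial : ℝ))) =
      ∏ i ∈ (Finset.Icc 1 N).erase j, (a i ^ s.count i * (1 / ((s.count i).factorial : ℝ))) := by
    refine Finset.prod_congr rfl fun i hi => ?_
    rw [Multiset.count_cons_of_ne (Finset.ne_of_mem_erase hi)]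
  rw [h, Multiset.count_cons_self, Nat.factorial_succ, pow_succ]
  have : ((s.count j).factorial : ℝ) ≠ 0 := by positivity
  push_cast
  field_simp

theorem sum_count {n N : ℕ} (h : n ≤ N) (p : n.Partition) :
    ∑ j ∈ Finset.Icc 1 N, j * p.parts.count j = n := by
  have h1 := Finset.sum_multiset_count_of_subset p.parts (Finset.Icc 1 N) (fun i hi => by
    have hi := Multiset.mem_toFinset.1 hi
    exact Finset.mem_Icc.2 ⟨p.parts_pos hi, (p.le_of_mem_parts hi).trans h⟩)
  rw [p.parts_sum] at h1
  conv_rhs => rw [h1]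
  exact Finset.sum_congr rfl fun i _ => by rw [smul_eq_mul, mul_comm]

theorem length_eq_card {n : ℕ} (p : n.Partition) : length p = p.parts.card := by
  unfold length componentCount
  refine Multiset.sum_count_eq_card fun i hi => ?_
  exact Finset.mem_Icc.2 ⟨p.parts_pos hi, p.le_of_mem_parts hi⟩

theorem sum_remove_part {n j : ℕ} (hj1 : 1 ≤ j) (hjn : j ≤ n) (F : Multiset ℕ → ℝ) :
    ∑ p : n.Partition, (p.parts.count j : ℝ) * F p.parts =
    ∑ q : (n - j).Partition, ((q.parts.count j + 1 : ℕ) : ℝ) * F (j ::ₘ q.parts) := by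
  symm
  refine Finset.sum_bij_ne_zero
    (fun q _ _ => (⟨j ::ₘ q.parts, ?_, ?_⟩ : n.Partition)) ?_ ?_ ?_ ?_
  · intro i hi
    rcases Multiset.mem_cons.1 hi with rfl | hi
    · exact hj1
    · exact q.parts_pos hi
  · rw [Multiset.sum_cons, q.parts_sum]
    omega
  · intros
    exact Finset.mem_univ _
  · intro q _ _ q' _ _ h
    have := congrArg Nat.Partition.parts h
    exact Nat.Partition.ext ((Multiset.cons_inj_right j).1 this)
  · intro p _ hp
    have hmem : j ∈ p.parts := by
      by_contra hc
      exact hp (by rw [Multiset.count_eq_zero_of_notMem hc]; simp)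
    have hc := Multiset.cons_erase hmem
    refine ⟨⟨p.parts.erase j, fun hi => p.parts_pos (Multiset.mem_of_mem_erase hi), ?_⟩,
      Finset.mem_univ _, ?_, ?_⟩
    · have := congrArg Multiset.sum hc
      rw [Multiset.sum_cons, p.parts_sum] at this
      omega
    · simp only [hc]
      rw [← Multiset.count_cons_self, hc]
      exact hp
    · exact Nat.Partition.ext hc
  · intro q _ _
    simp only [Multiset.count_cons_self]

theorem sum_blockWeight (α : ℝ) (N : ℕ) (n : ℕ) : n ≤ N → ∀ θ : ℝ,
    ∑ p : n.Partition, risingFactorial θ α p.parts.card *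
      blockWeight (fun i => risingFactorial (1 - α) 1 (i - 1) / (i.factorial : ℝ)) N p.parts =
    risingFactorial θ 1 n / (n.factorial : ℝ) := by
  induction n using Nat.strong_induction_on with
  | _ n ih =>
  intro hn θ
  set a : ℕ → ℝ := fun i => risingFactorial (1 - α) 1 (i - 1) / (i.factorial : ℝ) with ha
  rcases Nat.eq_zero_or_pos n with rfl | hpos
  · simp [risingFactorial, blockWeight]
  have hn0 : (n : ℝ) ≠ 0 := by positivity
  apply mul_left_cancel₀ hn0
  have h1 : (n : ℝ) * ∑ p : n.Partition, risingFactorial θ α p.parts.card *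
      blockWeight a N p.parts = ∑ j ∈ Finset.Icc 1 n, (j : ℝ) * ∑ p : n.Partition,
        (p.parts.count j : ℝ) *
          (risingFactorial θ α p.parts.card * blockWeight a N p.parts) := by
    simp_rw [Finset.mul_sum]
    rw [Finset.sum_comm]
    refine Finset.sum_congr rfl fun p _ => ?_
    simp_rw [← mul_assoc, ← Finset.sum_mul]
    congr 2
    exact_mod_cast (sum_count le_rfl p).symm
  have h2 : ∀ j ∈ Finset.Icc 1 n, (j : ℝ) * ∑ p : n.Partition,
        (p.parts.count j : ℝ) * (risingFactorial θ α p.parts.card * blockWeight a N p.parts) =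
      θ * (risingFactorial (1 - α) 1 (j - 1) / ((j - 1).factorial : ℝ) *
        (risingFactorial (θ + α) 1 (n - j) / ((n - j).factorial : ℝ))) := by
    intro j hj
    obtain ⟨hj1, hjn⟩ := Finset.mem_Icc.1 hj
    rw [sum_remove_part hj1 hjn
      (fun s => risingFactorial θ α s.card * blockWeight a N s)]
    rw [← ih (n - j) (by omega) (by omega) (θ + α), Finset.mul_sum, Finset.mul_sum,
      Finset.mul_sum]
    refine Finset.sum_congr rfl fun q _ => ?_
    have hb := blockWeight_cons a N q.parts (Finset.mem_Icc.2 ⟨hj1, hjn.trans hn⟩)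
    have haj : (j : ℝ) * a j = risingFactorial (1 - α) 1 (j - 1) / ((j - 1).factorial : ℝ) := by
      obtain ⟨i, rfl⟩ : ∃ i, j = i + 1 := ⟨j - 1, by omega⟩
      simp only [ha, Nat.add_sub_cancel, Nat.factorial_succ]
      have : (i.factorial : ℝ) ≠ 0 := by positivity
      push_cast
      field_simp
    rw [Multiset.card_cons, risingFactorial_succ', ← haj, mul_left_comm _ (θ * _), hb]
    ring
  rw [h1, Finset.sum_congr rfl h2, ← Finset.mul_sum]
  obtain ⟨m, rfl⟩ : ∃ m, n = m + 1 := ⟨n - 1, by omega⟩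
  have h3 := vandermonde (1 - α) (θ + α) m
  rw [Finset.Nat.sum_antidiagonal_eq_sum_range_succ_mk] at h3
  have h4 : ∑ j ∈ Finset.Icc 1 (m + 1),
      risingFactorial (1 - α) 1 (j - 1) / ((j - 1).factorial : ℝ) *
        (risingFactorial (θ + α) 1 (m + 1 - j) / ((m + 1 - j).factorial : ℝ)) =
      risingFactorial (θ + 1) 1 m / (m.factorial : ℝ) := by
    rw [show θ + 1 = 1 - α + (θ + α) by ring, ← h3, Finset.range_eq_Ico,
      ← Finset.Ico_add_one_right_eq_Icc, ← Finset.sum_Ico_add' _ 0 (m + 1) 1]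
    refine Finset.sum_congr rfl fun j _ => ?_
    simp
  rw [h4, risingFactorial_succ', Nat.factorial_succ]
  have : (m.factorial : ℝ) ≠ 0 := by positivity
  push_cast
  field_simp

theorem sum_pitmanWeight (n : ℕ) (α : ℝ) {θ : ℝ} (hθ : 0 < θ) :
    ∑ p : n.Partition, pitmanWeight n α θ p = 1 := by
  have h := sum_blockWeight α n n le_rfl θ
  have h1 : ∀ p : n.Partition, pitmanWeight n α θ p =
      (n.factorial : ℝ) / risingFactorial θ 1 n * (risingFactorial θ α p.parts.card *
        blockWeight (fun i => risingFactorial (1 - α) 1 (i - 1) / (i.factorial : ℝ)) n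
          p.parts) := by
    intro p
    unfold pitmanWeight blockWeight
    rw [length_eq_card]
    unfold componentCount
    ring
  rw [Finset.sum_congr rfl fun p _ => h1 p, ← Finset.mul_sum, h]
  have h2 := (risingFactorial_pos hθ zero_le_one n).ne'
  have h3 : (n.factorial : ℝ) ≠ 0 := by positivity
  field_simp

/-- The distribution of a Pitman partition of `n` with parameters `α ∈ [0, 1)` and `θ > 0`. -/
def pitmanPMF (n : ℕ) (α θ : ℝ) (hα0 : 0 ≤ α) (hα1 : α < 1) (hθ : 0 < θ) :
    PMF n.Partition :=
  PMF.ofFintype (fun p => ENNReal.ofReal (pitmanWeight n α θ p)) (by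
    rw [← ENNReal.ofReal_sum_of_nonneg fun p _ => pitmanWeight_nonneg n hα0 hα1 hθ p,
      sum_pitmanWeight n α hθ, ENNReal.ofReal_one])

/-- The discrete σ-algebra on the finite set of partitions of `n`. -/
instance instMeasurableSpacePartition (n : ℕ) : MeasurableSpace n.Partition := ⊤

instance instDiscreteMeasurableSpacePartition (n : ℕ) :
    DiscreteMeasurableSpace n.Partition := ⟨fun _ => trivial⟩

/-- The `r`-th moment of the normalized length
`α K / (θ (((n + θ) / θ)^α - 1))`, where `K` is the length of a Pitman partition of `n`. -/
def normalizedMoment (n : ℕ) (α θ : ℝ) (hα0 : 0 ≤ α) (hα1 : α < 1) (hθ : 0 < θ) (r : ℕ) : ℝ :=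
  ∫ p : n.Partition,
    (α * (length p : ℝ) / (θ * (((n + θ) / θ) ^ α - 1))) ^ r
    ∂(pitmanPMF n α θ hα0 hα1 hθ).toMeasure

end PitmanPartition

end

/-!
The normalization in the Pitman sampling formula is available for every value of `θ`. Comparing the
formulas for `θ` and `θ + m α` gives the rising factorial moments of `θ + α K` exactly:
`E (θ + α K)_{m;α} = (θ)_{m;α} (θ + m α)_n / (θ)_n` (`mean_risingFactorial`).

The ratio `(θ + a)_n / (θ)_n` equals `s ^ a (1 - a (a - 1) / (2 θ) + …)` with `s = (n + θ) / θ`. This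
follows by summing the expansion of `log (1 + a / x) - a log (1 + 1 / x)` over `x = θ, …, θ + n - 1`:
the second order term is a telescoping difference of `1 / x`, and the remaining terms are
`O (x ^ (-3))`, with sum `O (θ ^ (-2))` (`abs_log_risingFactorial_ratio_le`,
`isBigO_risingFactorial_ratio`). Together with `(θ)_{m;α} = θ ^ m (1 + α m (m - 1) / (2 θ) + …)`, the
two coefficients of `1 / θ` add up to `m ^ 2 α (1 - α) / 2`.

With `ε = s ^ (-α)`, put `Z = (θ + α K) / (θ s ^ α)` and `δ = α ε / θ`. The quantity in the theorem is
`W = (Z - ε) / (1 - ε)`, because `θ s ^ α ε = θ`. Replacing the factors `Z + j δ` of the rising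
factorial by `W` one at a time, that is, by induction on `k`, gives
`E (W ^ k (Z)_{m;δ}) = 1 + (k + m) ^ 2 α (1 - α) / (2 θ) + O (1 / n + ε / θ + 1 / θ ^ 2)`
(`isBigO_mean_pow_mul_risingFactorial`). At `m = 0` this is the sharper expansion
`isBigO_normalizedMoment`, from which both claims follow.
-/

noncomputable section

namespace PitmanPartition

open Filter Asymptotics

/-! ### Moments of the length -/

theorem risingFactorial_add (x y : ℝ) (i j : ℕ) :
    risingFactorial x y (i + j) = risingFactorial x y i * risingFactorial (x + i * y) y j := by
  unfold risingFactorial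
  rw [Finset.prod_range_add]
  congr 1
  refine Finset.prod_congr rfl fun k _ => ?_
  push_cast
  ring

theorem risingFactorial_mul_mul (c x y : ℝ) (i : ℕ) :
    risingFactorial (c * x) (c * y) i = c ^ i * risingFactorial x y i := by
  unfold risingFactorial
  rw [← Finset.card_range i, ← Finset.prod_const, Finset.card_range, ← Finset.prod_mul_distrib]
  exact Finset.prod_congr rfl fun k _ => by ring

/-- The expectation of `f` under the Pitman sampling formula, as a sum over the partitions of `n`.
The sum makes sense without the positivity that `pitmanPMF` asks for. -/
def mean (n : ℕ) (α θ : ℝ) (f : n.Partition → ℝ) : ℝ :=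
  ∑ p : n.Partition, pitmanWeight n α θ p * f p

theorem normalizedMoment_eq_mean (n : ℕ) (α θ : ℝ) (hα0 : 0 ≤ α) (hα1 : α < 1) (hθ : 0 < θ)
    (r : ℕ) : normalizedMoment n α θ hα0 hα1 hθ r =
      mean n α θ (fun p => (α * (length p : ℝ) / (θ * (((n + θ) / θ) ^ α - 1))) ^ r) := by
  unfold normalizedMoment mean
  rw [PMF.integral_eq_sum]
  refine Finset.sum_congr rfl fun p _ => ?_
  rw [pitmanPMF, PMF.ofFintype_apply,
    ENNReal.toReal_ofReal (pitmanWeight_nonneg n hα0 hα1 hθ p), smul_eq_mul]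

/-- The rising factorial moments of `θ + α K`, where `K` is the length. The weight of a partition
at `θ`, times `(θ + α K)_{m;α}`, is proportional to its weight at `θ + m α`, and those weights sum
to one. -/
theorem mean_risingFactorial (n : ℕ) {α θ : ℝ} (hα0 : 0 ≤ α) (hθ : 0 < θ) (m : ℕ) :
    mean n α θ (fun p => risingFactorial (θ + α * length p) α m) =
      risingFactorial θ α m * (risingFactorial (θ + m * α) 1 n / risingFactorial θ 1 n) := by
  have hθ' : 0 < θ + m * α := by positivity
  have h1 := (risingFactorial_pos hθ zero_le_one n).ne'
  have h2 := (risingFactorial_pos hθ' zero_le_one n).ne'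
  suffices h : _ = _ * ∑ p : n.Partition, pitmanWeight n α (θ + m * α) p by
    rwa [sum_pitmanWeight n α hθ', mul_one] at h
  rw [Finset.mul_sum, mean]
  refine Finset.sum_congr rfl fun p _ => ?_
  have h3 : risingFactorial θ α (length p) * risingFactorial (θ + α * length p) α m =
      risingFactorial θ α m * risingFactorial (θ + m * α) α (length p) := by
    rw [mul_comm α, ← risingFactorial_add, ← risingFactorial_add, add_comm]
  unfold pitmanWeight
  generalize θ + m * α = φ at *
  generalize (∏ i ∈ Finset.Icc 1 n, (_ : ℝ)) = B
  field_simp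
  linear_combination B * h3

/-! ### Logarithms of ratios of rising factorials -/

theorem abs_log_one_add_sub_le {t : ℝ} (ht : |t| ≤ 1 / 2) :
    |Real.log (1 + t) - (t - t ^ 2 / 2)| ≤ 2 * |t| ^ 3 := by
  have h := Real.abs_log_sub_add_sum_range_le (x := -t) (by rw [abs_neg]; linarith) 2
  simp only [Finset.sum_range_succ, Finset.sum_range_zero, abs_neg, sub_neg_eq_add] at h
  norm_num at h
  calc _ = |-t + t ^ 2 / 2 + Real.log (1 + t)| := by congr 1; ring
    _ ≤ _ := h
    _ ≤ 2 * |t| ^ 3 := by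
      rw [div_le_iff₀ (by linarith)]
      nlinarith [pow_nonneg (abs_nonneg t) 3]

/-- One step of the telescoping sum for `log ((x + a)_n / (x)_n)`. The coefficient `a (a - 1) / 2`
is the one that cancels the terms of order `x ^ (-2)`. -/
theorem abs_log_ratio_step_le {a : ℝ} (ha : 0 ≤ a) {x : ℝ} (hx : 2 * (a + 1) ≤ x) :
    |Real.log ((x + a) / x) - a * Real.log ((x + 1) / x)
        - a * (a - 1) / 2 * (1 / (x + 1) - 1 / x)| ≤
      (2 * a ^ 3 + 2 * a + |a * (a - 1) / 2|) * (1 / x ^ 3) := by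
  have hx0 : 0 < x := by linarith
  have e1 : (x + a) / x = 1 + a / x := by field_simp
  have e2 : (x + 1) / x = 1 + 1 / x := by field_simp
  have h1 := abs_log_one_add_sub_le (t := a / x) (by
    rw [abs_of_nonneg (by positivity), div_le_iff₀ hx0]; linarith)
  have h2 := abs_log_one_add_sub_le (t := 1 / x) (by
    rw [abs_of_nonneg (by positivity), div_le_iff₀ hx0]; linarith)
  rw [abs_of_nonneg (show 0 ≤ a / x by positivity)] at h1
  rw [abs_of_nonneg (show 0 ≤ 1 / x by positivity)] at h2
  have h3 : |1 / (x * (x + 1)) - 1 / x ^ 2| ≤ 1 / x ^ 3 := by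
    have : 1 / (x * (x + 1)) - 1 / x ^ 2 = -(1 / (x ^ 2 * (x + 1))) := by field_simp; ring
    rw [this, abs_neg, abs_of_nonneg (by positivity)]
    refine one_div_le_one_div_of_le (by positivity) ?_
    nlinarith [pow_pos hx0 2]
  rw [e1, e2]
  set u := Real.log (1 + a / x) - (a / x - (a / x) ^ 2 / 2) with hu
  set v := Real.log (1 + 1 / x) - (1 / x - (1 / x) ^ 2 / 2) with hv
  set w := 1 / (x * (x + 1)) - 1 / x ^ 2 with hw
  have key : Real.log (1 + a / x) - a * Real.log (1 + 1 / x)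
      - a * (a - 1) / 2 * (1 / (x + 1) - 1 / x) = u - a * v + a * (a - 1) / 2 * w := by
    rw [hu, hv, hw]
    field_simp
    ring
  rw [key]
  calc _ ≤ |u| + |a * v| + |a * (a - 1) / 2 * w| :=
        (abs_add_le _ _).trans (add_le_add_left (abs_sub _ _) _)
    _ = |u| + a * |v| + |a * (a - 1) / 2| * |w| := by
        rw [abs_mul a v, abs_of_nonneg ha, abs_mul (a * (a - 1) / 2) w]
    _ ≤ 2 * (a / x) ^ 3 + a * (2 * (1 / x) ^ 3) + |a * (a - 1) / 2| * (1 / x ^ 3) := by gcongr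
    _ = _ := by ring

theorem sum_one_div_add_cube_le {x : ℝ} (hx : 2 ≤ x) (n : ℕ) :
    ∑ j ∈ Finset.range n, 1 / (x + j) ^ 3 ≤ 4 / x ^ 2 := by
  have h : ∀ n : ℕ, ∑ j ∈ Finset.range n, 1 / (x + j) ^ 3 ≤
      1 / (x - 1) ^ 2 - 1 / (x + n - 1) ^ 2 := by
    intro n
    induction n with
    | zero => simp
    | succ n ih =>
      rw [Finset.sum_range_succ]
      have hn : (0 : ℝ) ≤ n := n.cast_nonneg
      -- Comparison with a telescoping difference of `1 / (y - 1) ^ 2`.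
      have h1 : 1 / (x + n) ^ 3 ≤ 1 / (x + n - 1) ^ 2 - 1 / (x + n) ^ 2 := by
        set y := x + n
        have hy : 0 < y - 1 := by linarith
        have hy0 : 0 < y := by linarith
        rw [div_sub_div _ _ (by positivity) (by positivity), div_le_div_iff₀ (by positivity)
          (by positivity)]
        have : 0 ≤ y ^ 2 * (y ^ 2 - 1 + (y - 1)) := by
          have : 0 ≤ y ^ 2 - 1 := by nlinarith
          positivity
        nlinarith
      push_cast
      rw [show x + ((n : ℝ) + 1) - 1 = x + n by ring]
      linarith
  refine (h n).trans ?_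
  have h0 : 0 ≤ 1 / (x + n - 1) ^ 2 := by positivity
  have h1 : 1 / (x - 1) ^ 2 ≤ 4 / x ^ 2 := by
    have hy : 0 < x - 1 := by linarith
    rw [div_le_div_iff₀ (by positivity) (by positivity)]
    nlinarith
  linarith

theorem abs_log_risingFactorial_ratio_le {a : ℝ} (ha : 0 ≤ a) {x : ℝ} (hx : 2 * (a + 1) ≤ x)
    (n : ℕ) :
    |Real.log (risingFactorial (x + a) 1 n / risingFactorial x 1 n)
        - a * Real.log ((n + x) / x) - a * (a - 1) / 2 * (1 / (n + x) - 1 / x)| ≤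
      (2 * a ^ 3 + 2 * a + |a * (a - 1) / 2|) * (4 / x ^ 2) := by
  have hx0 : 0 < x := by linarith
  have key : Real.log (risingFactorial (x + a) 1 n / risingFactorial x 1 n)
        - a * Real.log ((n + x) / x) - a * (a - 1) / 2 * (1 / (n + x) - 1 / x) =
      ∑ j ∈ Finset.range n, (Real.log ((x + j + a) / (x + j))
        - a * Real.log ((x + j + 1) / (x + j))
        - a * (a - 1) / 2 * (1 / (x + j + 1) - 1 / (x + j))) := by
    induction n with
    | zero => simp [risingFactorial, hx0.ne']
    | succ n ih =>
      have p1 := (risingFactorial_pos (show 0 < x + a by linarith) zero_le_one n).ne'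
      have p2 := (risingFactorial_pos hx0 zero_le_one n).ne'
      have p3 : x + n ≠ 0 := by positivity
      have p4 : x + n + a ≠ 0 := by positivity
      have p5 : x + n + 1 ≠ 0 := by positivity
      rw [Finset.sum_range_succ, ← ih, risingFactorial_succ, risingFactorial_succ, mul_one,
        add_right_comm x a, Real.log_div (mul_ne_zero p1 p4) (mul_ne_zero p2 p3),
        Real.log_mul p1 p4, Real.log_mul p2 p3, Real.log_div p1 p2, Real.log_div p4 p3,
        Real.log_div p5 p3, Nat.cast_succ, show (n : ℝ) + 1 + x = x + n + 1 by ring,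
        add_comm (n : ℝ) x, Real.log_div p5 hx0.ne', Real.log_div p3 hx0.ne']
      ring
  rw [key]
  calc _ ≤ ∑ j ∈ Finset.range n, (2 * a ^ 3 + 2 * a + |a * (a - 1) / 2|) * (1 / (x + j) ^ 3) := by
        refine (Finset.abs_sum_le_sum_abs _ _).trans (Finset.sum_le_sum fun j _ => ?_)
        exact abs_log_ratio_step_le ha (hx.trans (by simp))
    _ ≤ _ := by
        rw [← Finset.mul_sum]
        exact mul_le_mul_of_nonneg_left (sum_one_div_add_cube_le (by linarith) n) (by positivity)

/-! ### Expansions to first order in the reciprocal of `θ` -/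

/-- First order expansions in a small quantity `t` multiply, up to an error `e` that absorbs
`t ^ 2`. -/
theorem isBigO_expansion_mul {ι : Type*} {l : Filter ι} {f g e t : ι → ℝ} {p q : ℝ}
    (ht : t =O[l] (fun _ => (1 : ℝ))) (ht2 : (fun i => t i ^ 2) =O[l] e)
    (he : e =O[l] (fun _ => (1 : ℝ)))
    (hf : (fun i => f i - (1 + p * t i)) =O[l] e) (hg : (fun i => g i - (1 + q * t i)) =O[l] e) :
    (fun i => f i * g i - (1 + (p + q) * t i)) =O[l] e := by
  have h1 : ∀ c : ℝ, (fun i => 1 + c * t i) =O[l] (fun _ => (1 : ℝ)) := fun c =>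
    (isBigO_refl _ _).add (ht.const_mul_left c)
  have hg1 : g =O[l] (fun _ => (1 : ℝ)) := by
    simpa using (hg.trans he).add (h1 q)
  have a1 := hf.mul hg1
  have a2 := (h1 p).mul hg
  simp only [mul_one, one_mul] at a1 a2
  refine ((a1.add a2).add (ht2.const_mul_left (p * q))).congr_left fun i => ?_
  ring

theorem isBigO_risingFactorial_div_pow {ι : Type*} {l : Filter ι} {θ e : ι → ℝ} (α : ℝ)
    (hθ : ∀ i, 0 < θ i) (ht : (fun i => (θ i)⁻¹) =O[l] (fun _ => (1 : ℝ)))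
    (ht2 : (fun i => (θ i)⁻¹ ^ 2) =O[l] e) (he : e =O[l] (fun _ => (1 : ℝ))) (m : ℕ) :
    (fun i => risingFactorial (θ i) α m / θ i ^ m - (1 + α * (m * (m - 1) / 2) * (θ i)⁻¹))
      =O[l] e := by
  induction m with
  | zero => simpa [risingFactorial] using isBigO_zero e l
  | succ m ih =>
    have h : (fun i => (θ i + m * α) / θ i - (1 + (m * α) * (θ i)⁻¹)) =O[l] e := by
      refine (isBigO_zero e l).congr_left fun i => ?_
      have := (hθ i).ne'
      field_simp
      ring
    refine (isBigO_expansion_mul ht ht2 he ih h).congr_left fun i => ?_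
    have := (hθ i).ne'
    rw [risingFactorial_succ, pow_succ]
    push_cast
    field_simp
    ring

/-- The expansion of `(θ + a)_n / (θ)_n`, which is `Γ (θ + n + a) / Γ (θ + n)` over
`Γ (θ + a) / Γ (θ)`, with an error uniform in `n`. -/
theorem isBigO_risingFactorial_ratio {ι : Type*} {l : Filter ι} {n : ι → ℕ} {θ e : ι → ℝ}
    {a : ℝ} (ha : 0 ≤ a) (hθ : ∀ i, 0 < θ i) (hθ_lim : Tendsto θ l atTop)
    (hn : (fun i => ((n i : ℝ) + θ i)⁻¹) =O[l] e) (ht2 : (fun i => (θ i)⁻¹ ^ 2) =O[l] e)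
    (he : Tendsto e l (𝓝 0)) :
    (fun i => risingFactorial (θ i + a) 1 (n i) / risingFactorial (θ i) 1 (n i) /
        ((n i + θ i) / θ i) ^ a - (1 + -(a * (a - 1) / 2) * (θ i)⁻¹)) =O[l] e := by
  set b := a * (a - 1) / 2 with hb
  set u : ι → ℝ := fun i =>
    Real.log (risingFactorial (θ i + a) 1 (n i) / risingFactorial (θ i) 1 (n i))
      - a * Real.log ((n i + θ i) / θ i) with hu
  have ht : Tendsto (fun i => (θ i)⁻¹) l (𝓝 0) := tendsto_inv_atTop_zero.comp hθ_lim
  have he1 : e =O[l] (fun _ => (1 : ℝ)) := he.isBigO_one ℝ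
  have h1 : (fun i => u i + b * (θ i)⁻¹) =O[l] e := by
    have h2 : (fun i => u i - b * (1 / (n i + θ i) - 1 / θ i)) =O[l] e := by
      refine IsBigO.trans (IsBigO.of_bound ((2 * a ^ 3 + 2 * a + |b|) * 4) ?_) ht2
      filter_upwards [hθ_lim.eventually_ge_atTop (2 * (a + 1))] with i hi
      have := abs_log_risingFactorial_ratio_le ha hi (n i)
      rw [Real.norm_eq_abs, Real.norm_of_nonneg (by positivity), inv_pow]
      calc _ ≤ _ := this
        _ = _ := by ring
    refine (h2.add (hn.const_mul_left b)).congr_left fun i => ?_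
    ring
  have hu0 : Tendsto u l (𝓝 0) := by
    have := (h1.trans_tendsto he).sub (ht.const_mul b)
    simpa using this
  have hu2 : (fun i => u i ^ 2) =O[l] e := by
    have h3 : (fun i => u i - b * (θ i)⁻¹) =O[l] (fun _ => (1 : ℝ)) :=
      (hu0.sub (ht.const_mul b)).isBigO_one ℝ
    have h4 := h1.mul h3
    simp only [mul_one] at h4
    refine (h4.add (ht2.const_mul_left (b ^ 2))).congr_left fun i => ?_
    ring
  have hexp : (fun i => Real.exp (u i) - 1 - u i) =O[l] e := by
    refine IsBigO.trans (IsBigO.of_bound 1 ?_) hu2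
    filter_upwards [hu0.eventually (Metric.closedBall_mem_nhds 0 one_pos)] with i hi
    rw [Real.dist_0_eq_abs] at hi
    rw [Real.norm_eq_abs, Real.norm_of_nonneg (by positivity), one_mul]
    exact Real.abs_exp_sub_one_sub_id_le hi
  refine (hexp.add h1).congr_left fun i => ?_
  have p0 := hθ i
  have p1 : 0 < (n i + θ i) / θ i := by positivity
  have p2 := risingFactorial_pos (show 0 < θ i + a by linarith) zero_le_one (n i)
  have p3 := risingFactorial_pos p0 zero_le_one (n i)
  have : Real.exp (u i) = risingFactorial (θ i + a) 1 (n i) / risingFactorial (θ i) 1 (n i) /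
        ((n i + θ i) / θ i) ^ a := by
    simp only [hu]
    rw [Real.exp_sub, Real.exp_log (by positivity), mul_comm a, ← Real.rpow_def_of_pos p1]
  rw [this]
  ring

theorem mean_risingFactorial_normalized (n : ℕ) {α θ : ℝ} (hα0 : 0 ≤ α) (hθ : 0 < θ) (m : ℕ) :
    mean n α θ (fun p => risingFactorial ((θ + α * length p) / (θ * ((n + θ) / θ) ^ α))
      (α / (θ * ((n + θ) / θ) ^ α)) m) =
      risingFactorial θ α m / θ ^ m *
        (risingFactorial (θ + m * α) 1 n / risingFactorial θ 1 n / ((n + θ) / θ) ^ (m * α)) := by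
  have hs : 0 < (n + θ) / θ := by positivity
  have hS : 0 < ((n + θ) / θ) ^ α := Real.rpow_pos_of_pos hs α
  have h1 : ((n + θ) / θ) ^ (m * α) = (((n + θ) / θ) ^ α) ^ m := by
    rw [mul_comm, Real.rpow_mul_natCast hs.le]
  have h2 : mean n α θ (fun p => risingFactorial ((θ + α * length p) / (θ * ((n + θ) / θ) ^ α))
      (α / (θ * ((n + θ) / θ) ^ α)) m) = (θ * ((n + θ) / θ) ^ α)⁻¹ ^ m *
      mean n α θ (fun p => risingFactorial (θ + α * length p) α m) := by
    unfold mean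
    rw [Finset.mul_sum]
    refine Finset.sum_congr rfl fun p _ => ?_
    generalize θ * ((n + θ) / θ) ^ α = c
    simp only [div_eq_inv_mul]
    rw [risingFactorial_mul_mul]
    ring
  rw [h2, mean_risingFactorial n hα0 hθ, h1, inv_pow, mul_pow]
  field_simp

/-- Mixed moments of the normalized length `W` and of `Z = (θ + α K) / (θ s ^ α)`, where
`s = (n + θ) / θ`. The mixture with rising factorials of step `δ = α / (θ s ^ α)` is what makes the
induction on `k` close, since `(1 - ε) W (Z)_{m;δ} = (Z)_{m+1;δ} - (m δ + ε) (Z)_{m;δ}`, where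
`ε = s ^ (-α)`. -/
theorem isBigO_mean_pow_mul_risingFactorial {ι : Type*} {l : Filter ι} {n : ι → ℕ}
    {θ e : ι → ℝ} {α : ℝ} (hα0 : 0 < α) (hθ : ∀ i, 0 < θ i) (hθ_lim : Tendsto θ l atTop)
    (hn_pos : ∀ᶠ i in l, 0 < n i)
    (hε : Tendsto (fun i => (((n i + θ i) / θ i) ^ α)⁻¹) l (𝓝 0))
    (hn : (fun i => ((n i : ℝ) + θ i)⁻¹) =O[l] e) (ht2 : (fun i => (θ i)⁻¹ ^ 2) =O[l] e)
    (hεt : (fun i => (((n i + θ i) / θ i) ^ α)⁻¹ * (θ i)⁻¹) =O[l] e)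
    (he : Tendsto e l (𝓝 0)) (k : ℕ) : ∀ m : ℕ,
    (fun i => mean (n i) α (θ i) (fun p =>
        (α * (length p : ℝ) / (θ i * (((n i + θ i) / θ i) ^ α - 1))) ^ k *
        risingFactorial ((θ i + α * length p) / (θ i * ((n i + θ i) / θ i) ^ α))
          (α / (θ i * ((n i + θ i) / θ i) ^ α)) m)
      - (1 + (((k : ℝ) + m) ^ 2 * (α * (1 - α) / 2)) * (θ i)⁻¹)) =O[l] e := by
  have ht : (fun i => (θ i)⁻¹) =O[l] (fun _ => (1 : ℝ)) :=
    (tendsto_inv_atTop_zero.comp hθ_lim).isBigO_one ℝ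
  have he1 : e =O[l] (fun _ => (1 : ℝ)) := he.isBigO_one ℝ
  induction k with
  | zero =>
    intro m
    refine (isBigO_expansion_mul ht ht2 he1 (isBigO_risingFactorial_div_pow α hθ ht ht2 he1 m)
      (isBigO_risingFactorial_ratio (a := m * α) (by positivity) hθ hθ_lim hn ht2 he)).congr_left
        fun i => ?_
    simp only [pow_zero, one_mul]
    rw [mean_risingFactorial_normalized (n i) hα0.le (hθ i)]
    push_cast
    ring
  | succ k ih =>
    intro m
    set S : ι → ℝ := fun i => ((n i + θ i) / θ i) ^ α with hS
    set M : ℕ → ℕ → ι → ℝ := fun k m i => mean (n i) α (θ i) (fun p =>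
        (α * (length p : ℝ) / (θ i * (S i - 1))) ^ k *
        risingFactorial ((θ i + α * length p) / (θ i * S i)) (α / (θ i * S i)) m) with hM
    -- Here `S⁻¹` is `ε`, and the step `δ` is written as `α ε / θ`. Positivity of `n` gives `S ≠ 1`,
    -- without which `W` would be a division by zero.
    have hrec : ∀ᶠ i in l, M (k + 1) m i = (1 - (S i)⁻¹)⁻¹ *
        (M k (m + 1) i - (m * (α * ((S i)⁻¹ * (θ i)⁻¹)) + (S i)⁻¹) * M k m i) := by
      filter_upwards [hn_pos] with i hi
      have hθi := hθ i
      have hni : (0 : ℝ) < n i := by exact_mod_cast hi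
      have hS1 : 1 < S i := Real.one_lt_rpow (by rw [lt_div_iff₀ hθi]; linarith) hα0
      have hS0 : S i ≠ 0 := by positivity
      have hS2 : S i - 1 ≠ 0 := by linarith
      simp only [hM, mean]
      rw [Finset.mul_sum, ← Finset.sum_sub_distrib, Finset.mul_sum]
      refine Finset.sum_congr rfl fun p _ => ?_
      rw [risingFactorial_succ, pow_succ]
      have : α * (length p : ℝ) / (θ i * (S i - 1)) = (1 - (S i)⁻¹)⁻¹ *
          ((θ i + α * length p) / (θ i * S i) - (S i)⁻¹) := by
        have : 1 - (S i)⁻¹ = (S i - 1) / S i := by field_simp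
        rw [this]
        field_simp
        ring
      nth_rewrite 2 [this]
      have : α / (θ i * S i) = α * ((S i)⁻¹ * (θ i)⁻¹) := by field_simp
      rw [this]
      ring
    have hinv : (fun i => (1 - (S i)⁻¹)⁻¹) =O[l] (fun _ => (1 : ℝ)) := by
      have := (tendsto_const_nhds (x := (1 : ℝ))).sub hε
      exact (this.inv₀ (by norm_num)).isBigO_one ℝ
    have hd : (fun i => m * (α * ((S i)⁻¹ * (θ i)⁻¹))) =O[l] e :=
      (hεt.const_mul_left α).const_mul_left m
    have h1 := ih (m + 1)
    have h2 := ((hd.trans he1).add (hε.isBigO_one ℝ)).mul (ih m)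
    have h3 := hd.mul ((isBigO_refl (fun _ => (1 : ℝ)) l).add
      (ht.const_mul_left (((k : ℝ) + m) ^ 2 * (α * (1 - α) / 2))))
    -- The coefficients of `1 / θ` in `h1` and in `ε` times the inductive hypothesis differ, which
    -- leaves a term of order `ε / θ`.
    have h4 := hεt.const_mul_left
      ((((k : ℝ) + m + 1) ^ 2 - ((k : ℝ) + m) ^ 2) * (α * (1 - α) / 2))
    simp only [one_mul, mul_one] at h2 h3
    have h5 := hinv.mul (((h1.sub h2).sub h3).add h4)
    simp only [one_mul] at h5
    refine h5.congr' ?_ EventuallyEq.rfl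
    have hne : ∀ᶠ i in l, (S i)⁻¹ < 1 := hε.eventually_lt_const one_pos
    filter_upwards [hrec, hne] with i hi hne
    have hne' : 1 - (S i)⁻¹ ≠ 0 := by linarith
    change _ = M (k + 1) m i - _
    rw [hi]
    simp only [hM]
    generalize mean _ _ _ _ = A
    generalize mean _ _ _ _ = B
    push_cast
    generalize (S i)⁻¹ = ε at *
    field_simp
    ring

/-- The two-term expansion of the moments of the normalized length, without any condition on the
growth of `θ` beyond `θ / n → 0`. -/
theorem isBigO_normalizedMoment {α : ℝ} (hα0 : 0 < α) (hα1 : α < 1) (r : ℕ)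
    {ι : Type*} {l : Filter ι} {n : ι → ℕ} {θ : ι → ℝ} (hθ : ∀ i, 0 < θ i)
    (hn_lim : Tendsto n l atTop) (hθ_lim : Tendsto θ l atTop)
    (hratio : Tendsto (fun i => θ i / (n i : ℝ)) l (𝓝 0)) :
    (fun i => normalizedMoment (n i) α (θ i) hα0.le hα1 (hθ i) r
        - (1 + (r : ℝ) ^ 2 * (α * (1 - α) / (2 * θ i))))
      =O[l] (fun i => (n i : ℝ)⁻¹ + (θ i / n i) ^ α * (θ i)⁻¹ + (θ i)⁻¹ ^ 2) := by
  have hn_pos : ∀ᶠ i in l, 0 < n i := hn_lim.eventually_gt_atTop 0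
  have ht : Tendsto (fun i => (θ i)⁻¹) l (𝓝 0) := tendsto_inv_atTop_zero.comp hθ_lim
  have hn0 : Tendsto (fun i => (n i : ℝ)⁻¹) l (𝓝 0) :=
    tendsto_inv_atTop_zero.comp (tendsto_natCast_atTop_atTop.comp hn_lim)
  have hρ : Tendsto (fun i => (θ i / (n i : ℝ)) ^ α) l (𝓝 0) := by
    simpa [Real.zero_rpow hα0.ne'] using hratio.rpow_const (Or.inr hα0.le)
  have he : Tendsto (fun i => (n i : ℝ)⁻¹ + (θ i / n i) ^ α * (θ i)⁻¹ + (θ i)⁻¹ ^ 2) l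
      (𝓝 0) := by
    simpa using (hn0.add (hρ.mul ht)).add (ht.pow 2)
  have hερ : ∀ᶠ i in l, (((n i + θ i) / θ i) ^ α)⁻¹ ≤ (θ i / (n i : ℝ)) ^ α := by
    filter_upwards [hn_pos] with i hi
    have hθi := hθ i
    have hni : (0 : ℝ) < n i := by exact_mod_cast hi
    rw [← Real.inv_rpow (by positivity), inv_div]
    exact Real.rpow_le_rpow (by positivity)
      (div_le_div_of_nonneg_left hθi.le hni (by linarith)) hα0.le
  have hnn : ∀ i, 0 ≤ (((n i + θ i) / θ i) ^ α)⁻¹ ∧ 0 ≤ (θ i / (n i : ℝ)) ^ α ∧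
      0 ≤ (θ i)⁻¹ ∧ 0 ≤ (n i : ℝ)⁻¹ := fun i => by
    have hθi := hθ i
    refine ⟨?_, ?_, ?_, ?_⟩ <;> positivity
  have hε : Tendsto (fun i => (((n i + θ i) / θ i) ^ α)⁻¹) l (𝓝 0) :=
    squeeze_zero' (Eventually.of_forall fun i => (hnn i).1) hερ hρ
  have key := isBigO_mean_pow_mul_risingFactorial (n := n)
    (e := fun i => (n i : ℝ)⁻¹ + (θ i / n i) ^ α * (θ i)⁻¹ + (θ i)⁻¹ ^ 2)
    hα0 hθ hθ_lim hn_pos hε ?_ ?_ ?_ he r 0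
  · refine key.congr_left fun i => ?_
    have := (hθ i).ne'
    rw [normalizedMoment_eq_mean]
    simp only [risingFactorial, Finset.range_zero, Finset.prod_empty, mul_one, Nat.cast_zero,
      add_zero]
    field_simp
  · refine IsBigO.of_bound' ?_
    filter_upwards [hn_pos] with i hi
    obtain ⟨-, h2, h3, h4⟩ := hnn i
    have hθi := hθ i
    have hni : (0 : ℝ) < n i := by exact_mod_cast hi
    rw [Real.norm_of_nonneg (by positivity), Real.norm_of_nonneg (by positivity)]
    have h5 : ((n i : ℝ) + θ i)⁻¹ ≤ (n i : ℝ)⁻¹ := inv_anti₀ hni (by linarith)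
    have h6 := mul_nonneg h2 h3
    nlinarith
  · refine IsBigO.of_bound' (Eventually.of_forall fun i => ?_)
    obtain ⟨-, h2, h3, h4⟩ := hnn i
    rw [Real.norm_of_nonneg (by positivity), Real.norm_of_nonneg (by positivity)]
    have h6 := mul_nonneg h2 h3
    linarith
  · refine IsBigO.of_bound' ?_
    filter_upwards [hερ] with i hi
    obtain ⟨h1, h2, h3, h4⟩ := hnn i
    rw [Real.norm_of_nonneg (by positivity), Real.norm_of_nonneg (by positivity)]
    nlinarith [mul_le_mul_of_nonneg_right hi h3]

end PitmanPartition

end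

theorem theorem3p2 {α : ℝ} (hα0 : 0 < α) (hα1 : α < 1) (r : ℕ) (hr : 1 ≤ r)
    {ι : Type*} (l : Filter ι) (n : ι → ℕ) (θ : ι → ℝ) (hθ : ∀ i, 0 < θ i)
    (hn_lim : Filter.Tendsto n l Filter.atTop)
    (hθ_lim : Filter.Tendsto θ l Filter.atTop)
    (hratio : Filter.Tendsto (fun i => θ i / (n i : ℝ)) l (𝓝 0)) :
    ((fun i => PitmanPartition.normalizedMoment (n i) α (θ i) hα0.le hα1 (hθ i) r - 1)
      =O[l] (fun i => θ i ^ (2 * α) / (n i : ℝ) ^ (2 * α) + θ i / (n i : ℝ) + 1 / θ i)) ∧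
    (Filter.Tendsto (fun i => θ i ^ (2 * α + 1) / (n i : ℝ) ^ (2 * α)) l (𝓝 0) →
      Filter.Tendsto (fun i => θ i ^ 2 / (n i : ℝ)) l (𝓝 0) →
      (fun i => PitmanPartition.normalizedMoment (n i) α (θ i) hα0.le hα1 (hθ i) r
          - (1 + (r : ℝ) ^ 2 * (α * (1 - α) / (2 * θ i))))
        =O[l] (fun i => θ i ^ (2 * α) / (n i : ℝ) ^ (2 * α) + θ i / (n i : ℝ)
          + 1 / θ i * (θ i ^ α / (n i : ℝ) ^ α + 1 / θ i))) := by
  have key := PitmanPartition.isBigO_normalizedMoment hα0 hα1 r hθ hn_lim hθ_lim hratio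
  have hle : ∀ᶠ i in l, (n i : ℝ)⁻¹ ≤ θ i / n i := by
    filter_upwards [hθ_lim.eventually_ge_atTop 1] with i hi
    rw [inv_eq_one_div]
    gcongr
  refine ⟨?_, fun _ _ => key.trans (Asymptotics.IsBigO.of_bound' ?_)⟩
  · have h1 : (fun i => (n i : ℝ)⁻¹ + (θ i / n i) ^ α * (θ i)⁻¹ + (θ i)⁻¹ ^ 2) =O[l]
        (fun i => θ i ^ (2 * α) / (n i : ℝ) ^ (2 * α) + θ i / (n i : ℝ) + 1 / θ i) := by
      refine Asymptotics.IsBigO.of_bound 2 ?_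
      filter_upwards [hle, hθ_lim.eventually_ge_atTop 1, hratio.eventually_le_const one_pos]
        with i h1 h2 h3
      have hθi := hθ i
      have h4 : (θ i / n i) ^ α ≤ 1 := Real.rpow_le_one (by positivity) h3 hα0.le
      have h5 : (θ i)⁻¹ ≤ 1 := inv_le_one_of_one_le₀ h2
      have h6 : 0 ≤ θ i ^ (2 * α) / (n i : ℝ) ^ (2 * α) := by positivity
      have h7 : 0 ≤ (θ i)⁻¹ := by positivity
      have h8 : 0 ≤ θ i / (n i : ℝ) := by positivity
      rw [Real.norm_of_nonneg (by positivity), Real.norm_of_nonneg (by positivity), one_div]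
      nlinarith [mul_le_mul_of_nonneg_right h4 h7, mul_le_mul_of_nonneg_right h5 h7]
    have h2 : (fun i => (r : ℝ) ^ 2 * (α * (1 - α) / (2 * θ i))) =O[l]
        (fun i => θ i ^ (2 * α) / (n i : ℝ) ^ (2 * α) + θ i / (n i : ℝ) + 1 / θ i) := by
      refine Asymptotics.IsBigO.of_bound ((r : ℝ) ^ 2 * (α * (1 - α) / 2))
        (Filter.Eventually.of_forall fun i => ?_)
      have hθi := hθ i
      have hα : 0 ≤ 1 - α := by linarith
      have h6 : 0 ≤ θ i ^ (2 * α) / (n i : ℝ) ^ (2 * α) + θ i / (n i : ℝ) := by positivity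
      rw [Real.norm_of_nonneg (by positivity), Real.norm_of_nonneg (by positivity)]
      calc _ = (r : ℝ) ^ 2 * (α * (1 - α) / 2) * (1 / θ i) := by field_simp
        _ ≤ _ := by gcongr; linarith
    refine ((key.trans h1).add h2).congr_left fun i => ?_
    ring
  · filter_upwards [hle] with i h1
    have hθi := hθ i
    have h6 : 0 ≤ θ i ^ (2 * α) / (n i : ℝ) ^ (2 * α) := by positivity
    rw [Real.norm_of_nonneg (by positivity), Real.norm_of_nonneg (by positivity),
      Real.div_rpow hθi.le (Nat.cast_nonneg _)]
    calc _ ≤ θ i / n i + θ i ^ α / (n i : ℝ) ^ α * (θ i)⁻¹ + (θ i)⁻¹ ^ 2 := by gcongr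
      _ = θ i / n i + 1 / θ i * (θ i ^ α / (n i : ℝ) ^ α + 1 / θ i) := by ring
      _ ≤ _ := by linarith
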